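/- **Conventions.** All rings are commutative with unit. For a finite group $G$, a $G$-Tambara functor $k$ is regarded as a product-preserving functor on all finite $G$-sets: it assigns to each finite $G$-set $X$ a ring $k(X)$ and to each map $X\to Y$ of finite $G$-sets a restriction $k(Y)\to k(X)$ (a ring homomorphism), a transfer $k(X)\to k(Y)$ (additive) and a norm $k(X)\to k(Y)$ (multiplicative). These are functorial, send finite disjoint unions to products, satisfy base change for transfers and norms along pullback squares (double coset formulae), and satisfy distributivity of norms over transfers along exponential diagrams. Morphisms are families of ring homomorphisms commuting with restrictions, transfers and norms. A nonzero $G$-Tambara functor $k$ is *field-like* if every morphism $k\to\ell$ with $\ell\neq 0$ is a monomorphism. The ring $k(G/e)$ carries the $G$-action induced by the automorphisms of the $G$-set $G/e$. For $H\le G$, the coinduction $\mathrm{Coind}_H^G\,\ell$ of an $H$-Tambara functor $\ell$ is the $G$-Tambara functor $X\mapsto \ell(\mathrm{Res}^G_H X)$. The coinduction of a ring $R$ with $H$-action is the ring with $G$-action $\mathrm{Coind}_H^G R=\mathrm{Map}_H(G,R)\cong \mathrm{Fun}(G/H,R)$. A field-like $G$-Tambara functor $k$ is *separated* if $k(G/e)\cong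 \mathrm{Coind}_H^G R$ as rings with $G$-action for some proper subgroup $H\subsetneq G$ and some ring $R$ with $H$-action; otherwise it is *clarified*. **Theorem.** Let $p$ be a prime, let $n\ge 0$, and let $k$ be a field-like $C_{p^n}$-Tambara functor, where $C_{p^n}$ is the cyclic group of order $p^n$. Then there exist $0\le s\le n$ and a clarified field-like $C_{p^s}$-Tambara functor $\ell$, where $C_{p^s}\le C_{p^n}$ is the subgroup of order $p^s$, such that the bottom level $\ell(C_{p^s}/e)$ is a field and $$k\;\cong\;\mathrm{Coind}_{C_{p^s}}^{C_{p^n}}\,\ell$$ as $C_{p^n}$-Tambara functors. -/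

import Mathlib

open CategoryTheory

universe u

/-- A finite `G`-set. -/
structure FinGSet (G : Type) [Group G] where
  carrier : Type
  [action : MulAction G carrier]
  [finite : Finite carrier]

namespace FinGSet

instance (G : Type) [Group G] : CoeSort (FinGSet G) Type := ⟨FinGSet.carrier⟩

attribute [instance] FinGSet.action FinGSet.finite

/-- The free transitive `G`-set `G/e`, i.e. `G` acting on itself by left multiplication. -/
def free (G : Type) [Group G] [Finite G] : FinGSet G where
  carrier := G

/-- The automorphism `x ↦ x * g` of the `G`-set `G/e`. -/
def rightMul {G : Type} [Group G] [Finite G] (g : G) : free G →[G] free G where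
  toFun := fun x : G => (x * g : G)
  map_smul' := fun a (x : G) => mul_assoc a x g

/-- The restriction of a finite `G`-set to a subgroup `H`. -/
def restrict {G : Type} [Group G] (H : Subgroup G) (X : FinGSet G) : FinGSet H where
  carrier := X.carrier

/-- A map of `G`-sets, regarded as a map of `H`-sets. -/
def restrictMap {G : Type} [Group G] (H : Subgroup G) {X Y : FinGSet G} (f : X →[G] Y) :
    X.restrict H →[H] Y.restrict H where
  toFun := f
  map_smul' := fun h x => f.map_smul (h : G) x

end FinGSet

/-- The square with top `g' : W → X`, left `f' : W → V`, right `f : X → Y`, bottom `g : V → Y`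
is a pullback square of sets. (A commutative square of `G`-sets is a pullback square of `G`-sets
if and only if it is one of underlying sets.) -/
def IsPullbackSquare {W X V Y : Type} (g' : W → X) (f' : W → V) (f : X → Y) (g : V → Y) : Prop :=
  (∀ w, f (g' w) = g (f' w)) ∧ ∀ x v, f x = g v → ∃! w, g' w = x ∧ f' w = v

/-- Given `q : A → X` and `f : X → Y`, the diagram
```
  X ←q- A ←e- E
  |f          |t
  Y ←---π---- P
```
is an exponential diagram (distributivity diagram): it exhibits `P` as the dependent product
`Π_f A = {(y, σ) | y : Y, σ : f⁻¹(y) → A a section of q}`, the set `E` as the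
pullback `X ×_Y Π_f A`, and `e` as the evaluation map `(x, (y, σ)) ↦ σ x`. -/
structure IsExponentialDiagram {A X Y E P : Type} (q : A → X) (f : X → Y)
    (e : E → A) (t : E → P) (π : P → Y) : Prop where
  isPullback : IsPullbackSquare (fun z => q (e z)) t f π
  existsUnique_section : ∀ (y : Y) (σ : {x : X // f x = y} → A), (∀ x, q (σ x) = x) →
    ∃! c : P, π c = y ∧ ∀ (z : E) (hz : f (q (e z)) = y), t z = c → e z = σ ⟨q (e z), hz⟩

/-- A `G`-Tambara functor, viewed as a product-preserving functor on all finite `G`-sets: a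
commutative ring `T(X)` for every finite `G`-set `X` and, for every map `f : X → Y` of finite
`G`-sets, a restriction `T(Y) → T(X)` (a ring map), a transfer `T(X) → T(Y)` (additive) and
a norm `T(X) → T(Y)` (multiplicative), each of them functorial, such that disjoint unions go to
products, transfers and norms satisfy base change along pullback squares (the double coset
formulae), and norms distribute over transfers along exponential diagrams. -/
structure TambaraFunctor (G : Type) [Group G] where
  obj : FinGSet G → Type u
  [commRing : ∀ X, CommRing (obj X)]
  /-- restriction -/
  res {X Y : FinGSet G} (f : X →[G] Y) : obj Y →+* obj X
  /-- transfer -/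
  tr {X Y : FinGSet G} (f : X →[G] Y) : obj X →+ obj Y
  /-- norm -/
  nm {X Y : FinGSet G} (f : X →[G] Y) : obj X →* obj Y
  res_id (X : FinGSet G) (a : obj X) : res (MulActionHom.id G) a = a
  tr_id (X : FinGSet G) (a : obj X) : tr (MulActionHom.id G) a = a
  nm_id (X : FinGSet G) (a : obj X) : nm (MulActionHom.id G) a = a
  res_comp {X Y Z : FinGSet G} (g : Y →[G] Z) (f : X →[G] Y) (a : obj Z) :
    res (g.comp f) a = res f (res g a)
  tr_comp {X Y Z : FinGSet G} (g : Y →[G] Z) (f : X →[G] Y) (a : obj X) :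
    tr (g.comp f) a = tr g (tr f a)
  nm_comp {X Y Z : FinGSet G} (g : Y →[G] Z) (f : X →[G] Y) (a : obj X) :
    nm (g.comp f) a = nm g (nm f a)
  /-- `T(∅) = 0` -/
  subsingleton_of_isEmpty (X : FinGSet G) : IsEmpty X → Subsingleton (obj X)
  /-- `T(X ⊔ Y) ≅ T(X) × T(Y)` via the restrictions along the two inclusions -/
  bijective_of_coprod {X Y Z : FinGSet G} (i : X →[G] Z) (j : Y →[G] Z) :
    Function.Bijective (Sum.elim i j) →
      Function.Bijective (fun a : obj Z => (res i a, res j a))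
  /-- base change for transfers -/
  res_tr {W X V Y : FinGSet G} (g' : W →[G] X) (f' : W →[G] V) (f : X →[G] Y) (g : V →[G] Y) :
    IsPullbackSquare g' f' f g → ∀ a : obj X, res g (tr f a) = tr f' (res g' a)
  /-- base change for norms -/
  res_nm {W X V Y : FinGSet G} (g' : W →[G] X) (f' : W →[G] V) (f : X →[G] Y) (g : V →[G] Y) :
    IsPullbackSquare g' f' f g → ∀ a : obj X, res g (nm f a) = nm f' (res g' a)
  /-- distributivity of norms over transfers -/
  nm_tr {A X Y E P : FinGSet G} (q : A →[G] X) (f : X →[G] Y)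
    (e : E →[G] A) (t : E →[G] P) (π : P →[G] Y) :
    IsExponentialDiagram q f e t π → ∀ a : obj A, nm f (tr q a) = tr π (nm t (res e a))

namespace TambaraFunctor

attribute [instance] TambaraFunctor.commRing

/-- A morphism of `G`-Tambara functors: ring maps in all levels, compatible with restrictions,
transfers and norms. -/
@[ext]
structure Hom {G : Type} [Group G] (k l : TambaraFunctor.{u} G) where
  app (X : FinGSet G) : k.obj X →+* l.obj X
  app_res {X Y : FinGSet G} (f : X →[G] Y) (a : k.obj Y) : app X (k.res f a) = l.res f (app Y a)
  app_tr {X Y : FinGSet G} (f : X →[G] Y) (a : k.obj X) : app Y (k.tr f a) = l.tr f (app X a)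
  app_nm {X Y : FinGSet G} (f : X →[G] Y) (a : k.obj X) : app Y (k.nm f a) = l.nm f (app X a)

/-- The category of `G`-Tambara functors. -/
instance (G : Type) [Group G] : Category (TambaraFunctor.{u} G) where
  Hom := Hom
  id k :=
    { app := fun X => RingHom.id _
      app_res := fun _ _ => rfl
      app_tr := fun _ _ => rfl
      app_nm := fun _ _ => rfl }
  comp φ ψ :=
    { app := fun X => (ψ.app X).comp (φ.app X)
      app_res := fun f a => by simp [φ.app_res, ψ.app_res]
      app_tr := fun f a => by simp [φ.app_tr, ψ.app_tr]
      app_nm := fun f a => by simp [φ.app_nm, ψ.app_nm] }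

/-- A Tambara functor is nonzero if some level is a nonzero ring. -/
def IsNonzero {G : Type} [Group G] (k : TambaraFunctor.{u} G) : Prop :=
  ∃ X : FinGSet G, Nontrivial (k.obj X)

/-- A nonzero Tambara functor `k` is field-like if every morphism from `k` to a nonzero
Tambara functor is a monomorphism. -/
def IsFieldLike {G : Type} [Group G] (k : TambaraFunctor.{u} G) : Prop :=
  k.IsNonzero ∧ ∀ (l : TambaraFunctor.{u} G) (φ : k ⟶ l), l.IsNonzero → Mono φ

/-- The bottom level `k(G/e)`. -/
def bottom {G : Type} [Group G] [Finite G] (k : TambaraFunctor.{u} G) : Type u :=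
  k.obj (FinGSet.free G)

instance {G : Type} [Group G] [Finite G] (k : TambaraFunctor.{u} G) : CommRing k.bottom :=
  k.commRing (FinGSet.free G)

/-- The action of `G` on `k(G/e)` by ring automorphisms: `g` acts as the restriction along
the automorphism `x ↦ x * g` of `G/e`. -/
instance {G : Type} [Group G] [Finite G] (k : TambaraFunctor.{u} G) :
    MulSemiringAction G k.bottom where
  smul g a := k.res (FinGSet.rightMul g) a
  one_smul a := by
    have h : FinGSet.rightMul (1 : G) = MulActionHom.id G := by
      ext x
      exact mul_one (M := G) x
    change k.res (FinGSet.rightMul 1) a = a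
    rw [h]
    exact k.res_id _ a
  mul_smul g g' a := by
    have h : FinGSet.rightMul (g * g') =
        (FinGSet.rightMul g').comp (FinGSet.rightMul g) := by
      ext x
      exact (mul_assoc (G := G) x g g').symm
    change k.res (FinGSet.rightMul (g * g')) a =
      k.res (FinGSet.rightMul g) (k.res (FinGSet.rightMul g') a)
    rw [h]
    exact k.res_comp _ _ a
  smul_zero g := map_zero (k.res (FinGSet.rightMul g))
  smul_add g := map_add (k.res (FinGSet.rightMul g))
  smul_one g := map_one (k.res (FinGSet.rightMul g))
  smul_mul g := map_mul (k.res (FinGSet.rightMul g))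

end TambaraFunctor

/-- The coinduction of an `H`-ring `R` to a `G`-ring: the ring `Map_H(G, R)` of functions
`f : G → R` with `f (h * x) = h • f x`, under pointwise operations. A choice of coset
representatives identifies it with `Fun(G/H, R)`. -/
def coindRing {G : Type} [Group G] (H : Subgroup G) (R : Type u) [CommRing R]
    [MulSemiringAction H R] : Subring (G → R) where
  carrier := {f | ∀ (h : H) (x : G), f (h * x) = h • f x}
  mul_mem' := fun ha hb h x => by simp [ha h x, hb h x]
  one_mem' := fun h x => by simp
  add_mem' := fun ha hb h x => by simp [ha h x, hb h x]
  zero_mem' := fun h x => by simp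
  neg_mem' := fun ha h x => by simp [ha h x]

/-- `G` acts on the coinduced ring by `(g • f) x = f (x * g)`. -/
instance {G : Type} [Group G] (H : Subgroup G) (R : Type u) [CommRing R]
    [MulSemiringAction H R] : MulSemiringAction G (coindRing H R) where
  smul g f := ⟨fun x => f.1 (x * g), fun h x => by
    change f.1 (h * x * g) = h • f.1 (x * g)
    rw [mul_assoc]
    exact f.2 h (x * g)⟩
  one_smul f := Subtype.ext (funext fun x => congrArg f.1 (mul_one x))
  mul_smul g g' f := Subtype.ext (funext fun x => congrArg f.1 (mul_assoc x g g').symm)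
  smul_zero _ := rfl
  smul_add _ _ _ := rfl
  smul_one _ := rfl
  smul_mul _ _ _ := rfl

namespace TambaraFunctor

/-- A field-like `G`-Tambara functor `k` is separated if `k(G/e)` is isomorphic, as a `G`-ring,
to the coinduction of an `H`-ring for some proper subgroup `H` of `G`. -/
def IsSeparated {G : Type} [Group G] [Finite G] (k : TambaraFunctor.{u} G) : Prop :=
  k.IsFieldLike ∧ ∃ H : Subgroup G, H ≠ ⊤ ∧
    ∃ (R : Type u) (_ : CommRing R) (_ : MulSemiringAction H R)
      (φ : k.bottom ≃+* coindRing H R), ∀ (g : G) (a : k.bottom), φ (g • a) = g • φ a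

/-- A field-like `G`-Tambara functor is clarified if it is not separated. -/
def IsClarified {G : Type} [Group G] [Finite G] (k : TambaraFunctor.{u} G) : Prop :=
  k.IsFieldLike ∧ ¬ k.IsSeparated

/-- The coinduction of an `H`-Tambara functor to a `G`-Tambara functor: precomposition with the
restriction functor from finite `G`-sets to finite `H`-sets. -/
def coind {G : Type} [Group G] (H : Subgroup G) (l : TambaraFunctor.{u} H) :
    TambaraFunctor.{u} G where
  obj X := l.obj (X.restrict H)
  res f := l.res (FinGSet.restrictMap H f)
  tr f := l.tr (FinGSet.restrictMap H f)
  nm f := l.nm (FinGSet.restrictMap H f)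
  res_id X a := l.res_id (X.restrict H) a
  tr_id X a := l.tr_id (X.restrict H) a
  nm_id X a := l.nm_id (X.restrict H) a
  res_comp g f a := l.res_comp (FinGSet.restrictMap H g) (FinGSet.restrictMap H f) a
  tr_comp g f a := l.tr_comp (FinGSet.restrictMap H g) (FinGSet.restrictMap H f) a
  nm_comp g f a := l.nm_comp (FinGSet.restrictMap H g) (FinGSet.restrictMap H f) a
  subsingleton_of_isEmpty X hX := l.subsingleton_of_isEmpty (X.restrict H) hX
  bijective_of_coprod i j h :=
    l.bijective_of_coprod (FinGSet.restrictMap H i) (FinGSet.restrictMap H j) h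
  res_tr _ _ _ _ h := l.res_tr _ _ _ _ h
  res_nm _ _ _ _ h := l.res_nm _ _ _ _ h
  nm_tr _ _ _ _ _ h := l.nm_tr _ _ _ _ _ h

end TambaraFunctor

/-!
Let `R = k(G/e)`. An element `a` of `k(X)` has a value `ev x a` in `R` at every point `x` of `X`,
its restriction along the orbit map `G/e → X` of `x`. Base change along the orbit maps
(`TambaraFunctor.ev_tr`, `TambaraFunctor.ev_nm`) shows that transfers and norms become sums and
products of values over fibres. Hence for any ideal `m` of `R`, invariant or not, evaluation modulo
`m` is a morphism `residue` from `k` to the Tambara functor `X ↦ Fun(X, R/m)`. If `k` is field-like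
and `m ≠ R`, this is a monomorphism, and monomorphisms are injective at every level, because kernel
pairs exist (`TambaraFunctor.injective_of_mono`).

Let `m` be a maximal ideal with stabilizer `H`. For an `H`-set `Y`, let `ℓ(Y) ⊆ Fun(Y, R/m)` be the
image of `k(G ×_H Y)` under evaluation at the points `(1, y)`. Induction preserves fibres, so `ℓ` is
an `H`-Tambara subfunctor of the functor of functions to `R/m` (`TambaraFunctor.localPart`), and
evaluation is a morphism from `k` to the coinduction of `ℓ`. It is injective by the above. For
surjectivity, the Chinese remainder theorem gives `d` in `R` which is `1` modulo `m` and vanishes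
modulo the other conjugates of `m`. The norm of `d` along `G × Y → G ×_H Y` is modulo `m` the
indicator function of the points `(1, y)`; multiplying by it and transferring along `G ×_H X → X`
yields preimages (`TambaraFunctor.toCoind_surjective`).

The bottom level of `ℓ` is the field `R/m`. As the elements of `ℓ` are functions, `ℓ` is field-like
(`TambaraFunctor.isFieldLike_of_isField_bottom`), and as a field has no nontrivial idempotents, `ℓ`
is not separated. This argument works for every finite group; for a cyclic group of order `p ^ n`
the order of `H` is a power of `p` by Lagrange's theorem.
-/

/-! ### Free `G`-sets and orbit maps -/

namespace FinGSet

variable {G : Type} [Group G]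

/-- The empty `G`-set. -/
def empty (G : Type) [Group G] : FinGSet G where
  carrier := Empty
  action :=
    { smul := fun _ x => x
      one_smul := fun _ => rfl
      mul_smul := fun _ _ _ => rfl }

/-- The unique map out of the empty `G`-set. -/
def fromEmpty (X : FinGSet G) : empty G →[G] X where
  toFun := Empty.elim
  map_smul' := fun _ x => Empty.elim x

/-- The free `G`-set `G × S`, where `G` acts on the first factor by left multiplication and `S`
is a mere set. -/
def freeOn (G : Type) [Group G] [Finite G] (S : Type) [Finite S] : FinGSet G where
  carrier := G × S
  action :=
    { smul := fun g x => (g * x.1, x.2)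
      one_smul := fun x => Prod.ext (one_mul x.1) rfl
      mul_smul := fun g g' x => Prod.ext (mul_assoc g g' x.1) rfl }

/-- The equivariant map `g ↦ g • x` from `G/e` to `X`. -/
def orbitMap [Finite G] {X : FinGSet G} (x : X) : free G →[G] X where
  toFun := fun g : G => g • x
  map_smul' := fun g (g' : G) => mul_smul g g' x

/-- The equivariant map `G × S → X` induced by a map of sets `S → X`. -/
def freeOnLift [Finite G] {S : Type} [Finite S] {X : FinGSet G} (j : S → X) :
    freeOn G S →[G] X where
  toFun := fun x : G × S => x.1 • j x.2
  map_smul' := fun g (x : G × S) => mul_smul g x.1 (j x.2)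

/-- The projection `G × S → G/e`. -/
def freeOnFst [Finite G] (S : Type) [Finite S] : freeOn G S →[G] free G where
  toFun := fun x : G × S => x.1
  map_smul' := fun _ _ => rfl

/-- The map `G × S → G × T` induced by a map of sets `S → T`. -/
def freeOnMap [Finite G] {S T : Type} [Finite S] [Finite T] (j : S → T) :
    freeOn G S →[G] freeOn G T where
  toFun := fun x : G × S => (x.1, j x.2)
  map_smul' := fun _ _ => rfl

/-- The inclusion of the copy of `G/e` in `G × S` indexed by `s`. -/
def freeOnIncl [Finite G] {S : Type} [Finite S] (s : S) : free G →[G] freeOn G S where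
  toFun := fun g : G => (g, s)
  map_smul' := fun _ _ => rfl

end FinGSet

namespace TambaraFunctor

open FinGSet

variable {G : Type} [Group G]

/-! ### Transfers and norms along fold maps -/

theorem res_tr_of_injective (k : TambaraFunctor.{u} G) {X Y : FinGSet G} (i : X →[G] Y)
    (hi : Function.Injective i) (a : k.obj X) : k.res i (k.tr i a) = a := by
  have h := k.res_tr (MulActionHom.id G) (MulActionHom.id G) i i
    ⟨fun _ => rfl, fun x v h => ⟨x, ⟨rfl, hi h⟩, fun _ h => h.1⟩⟩ a
  rw [h, k.res_id, k.tr_id]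

theorem res_nm_of_injective (k : TambaraFunctor.{u} G) {X Y : FinGSet G} (i : X →[G] Y)
    (hi : Function.Injective i) (a : k.obj X) : k.res i (k.nm i a) = a := by
  have h := k.res_nm (MulActionHom.id G) (MulActionHom.id G) i i
    ⟨fun _ => rfl, fun x v h => ⟨x, ⟨rfl, hi h⟩, fun _ h => h.1⟩⟩ a
  rw [h, k.res_id, k.nm_id]

theorem subsingleton_empty (k : TambaraFunctor.{u} G) : Subsingleton (k.obj (empty G)) :=
  k.subsingleton_of_isEmpty _ (inferInstanceAs (IsEmpty Empty))

theorem res_tr_of_disjoint (k : TambaraFunctor.{u} G) {X Y Z : FinGSet G} (i : X →[G] Z)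
    (j : Y →[G] Z) (h : ∀ x y, i x ≠ j y) (a : k.obj X) : k.res j (k.tr i a) = 0 := by
  have := k.subsingleton_empty
  rw [k.res_tr (fromEmpty X) (fromEmpty Y) i j
    ⟨fun w => Empty.elim w, fun x v hxv => (h x v hxv).elim⟩ a,
    Subsingleton.elim (k.res (fromEmpty X) a) 0, map_zero]

theorem res_nm_of_disjoint (k : TambaraFunctor.{u} G) {X Y Z : FinGSet G} (i : X →[G] Z)
    (j : Y →[G] Z) (h : ∀ x y, i x ≠ j y) (a : k.obj X) : k.res j (k.nm i a) = 1 := by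
  have := k.subsingleton_empty
  rw [k.res_nm (fromEmpty X) (fromEmpty Y) i j
    ⟨fun w => Empty.elim w, fun x v hxv => (h x v hxv).elim⟩ a,
    Subsingleton.elim (k.res (fromEmpty X) a) 1, map_one]

/-- The norm of zero along a surjection is zero: this is distributivity for the exponential
diagram over `∅ → X → Y`, whose dependent product is empty. -/
theorem nm_zero_of_surjective (k : TambaraFunctor.{u} G) {X Y : FinGSet G} (f : X →[G] Y)
    (hf : Function.Surjective f) : k.nm f 0 = 0 := by
  have := k.subsingleton_empty
  have h := k.nm_tr (fromEmpty X) f (MulActionHom.id G) (MulActionHom.id G) (fromEmpty Y)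
    ⟨⟨fun w => Empty.elim w, fun _ v => Empty.elim v⟩, fun y σ => by
      obtain ⟨x, hx⟩ := hf y
      exact Empty.elim (σ ⟨x, hx⟩)⟩ 0
  rw [map_zero (k.tr _), k.res_id, k.nm_id, map_zero (k.tr _)] at h
  exact h

section Finite

variable [Finite G]

theorem nontrivial_bottom {k : TambaraFunctor.{u} G} (hk : k.IsNonzero) :
    Nontrivial k.bottom := by
  obtain ⟨X, hX⟩ := hk
  by_contra h
  -- `G × X` is free and covers `X`, so a zero bottom level forces `1 = nm 1 = nm 0 = 0`.
  have h0 : (0 : k.obj (free G)) = 1 :=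
    (not_nontrivial_iff_subsingleton.1 h).elim _ _
  have h1 : (0 : k.obj (freeOn G X)) = 1 := by
    simpa using congrArg (k.res (freeOnFst X.carrier)) h0
  have h2 := congrArg (k.nm (freeOnLift (id : X → X))) h1
  rw [map_one, nm_zero_of_surjective] at h2
  · exact zero_ne_one h2
  · exact fun x => ⟨((1 : G), x), one_smul G x⟩

/-- Elements over `G × S` are determined by their restrictions to the copies of `G/e`, by additivity
and induction on `S`. -/
theorem freeOn_ext (k : TambaraFunctor.{u} G) {S : Type} [Finite S] {a b : k.obj (freeOn G S)}
    (h : ∀ s : S, k.res (freeOnIncl s) a = k.res (freeOnIncl s) b) : a = b := by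
  -- `Finite T` also occurs in the statement, so the motive has to quantify over its proofs.
  suffices H : ∀ (T : Type) [Finite T], (fun T : Type => ∀ (_ : Finite T)
      (a b : k.obj (freeOn G T)),
      (∀ s : T, k.res (freeOnIncl s) a = k.res (freeOnIncl s) b) → a = b) T from
    H S inferInstance a b h
  clear h a b
  intro T _
  induction T using Finite.induction_empty_option with
  | of_equiv e ih =>
    rename_i S T
    intro hT a b h
    have : Finite S := Finite.of_equiv _ e.symm
    have h1 := ih this (k.res (freeOnMap e) a) (k.res (freeOnMap e) b) fun s => by
      rw [← k.res_comp, ← k.res_comp]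
      exact h (e s)
    have h2 := congrArg (k.res (freeOnMap e.symm)) h1
    rw [← k.res_comp, ← k.res_comp] at h2
    have h3 : (freeOnMap e).comp (freeOnMap e.symm) = MulActionHom.id G (X := freeOn G T) := by
      ext x
      exact Prod.ext rfl (e.apply_symm_apply _)
    rw [h3, k.res_id, k.res_id] at h2
    exact h2
  | h_empty =>
    intro _ a b _
    exact (k.subsingleton_of_isEmpty _ ⟨fun x : G × PEmpty => x.2.elim⟩).elim _ _
  | h_option ih =>
    rename_i S _
    intro hT a b h
    refine (k.bijective_of_coprod (freeOnMap (some : S → Option S))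
      (freeOnIncl (none : Option S)) ⟨?_, ?_⟩).1 (Prod.ext ?_ (h none))
    · rintro (⟨x, s⟩ | x) (⟨y, t⟩ | y) hxy
      · obtain ⟨h1, h2⟩ := Prod.ext_iff.1 hxy
        cases h1
        cases h2
        rfl
      · cases (Prod.ext_iff.1 hxy).2
      · cases (Prod.ext_iff.1 hxy).2
      · cases (Prod.ext_iff.1 hxy).1
        rfl
    · rintro ⟨x, _ | s⟩
      · exact ⟨Sum.inr x, rfl⟩
      · exact ⟨Sum.inl (x, s), rfl⟩
    · refine ih inferInstance _ _ fun s => ?_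
      rw [← k.res_comp, ← k.res_comp]
      exact h (some s)

theorem freeOnIncl_injective {S : Type} [Finite S] (s : S) :
    Function.Injective (freeOnIncl (G := G) s) :=
  fun _ _ h => (Prod.ext_iff.1 h).1

theorem freeOnIncl_ne {S : Type} [Finite S] {s t : S} (h : s ≠ t) (x y : free G) :
    freeOnIncl s x ≠ freeOnIncl t y :=
  fun e => h (Prod.ext_iff.1 e).2

/-- The transfer along the fold map `G × S → G/e` is summation. -/
theorem tr_freeOnFst (k : TambaraFunctor.{u} G) {S : Type} [Fintype S]
    (a : k.obj (freeOn G S)) :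
    k.tr (freeOnFst S) a = ∑ s : S, k.res (freeOnIncl s) a := by
  have h : a = ∑ s : S, k.tr (freeOnIncl s) (k.res (freeOnIncl s) a) := by
    refine k.freeOn_ext fun t => ?_
    rw [map_sum, Finset.sum_eq_single t, res_tr_of_injective _ _ (freeOnIncl_injective t)]
    · intro s _ hs
      exact k.res_tr_of_disjoint _ _ (freeOnIncl_ne hs) _
    · simp
  conv_lhs => rw [h]
  rw [map_sum]
  refine Finset.sum_congr rfl fun s _ => ?_
  rw [← k.tr_comp]
  exact k.tr_id _ _

/-- The norm along the fold map `G × S → G/e` is multiplication. -/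
theorem nm_freeOnFst (k : TambaraFunctor.{u} G) {S : Type} [Fintype S]
    (a : k.obj (freeOn G S)) :
    k.nm (freeOnFst S) a = ∏ s : S, k.res (freeOnIncl s) a := by
  have h : a = ∏ s : S, k.nm (freeOnIncl s) (k.res (freeOnIncl s) a) := by
    refine k.freeOn_ext fun t => ?_
    rw [map_prod, Finset.prod_eq_single t, res_nm_of_injective _ _ (freeOnIncl_injective t)]
    · intro s _ hs
      exact k.res_nm_of_disjoint _ _ (freeOnIncl_ne hs) _
    · simp
  conv_lhs => rw [h]
  rw [map_prod]
  refine Finset.prod_congr rfl fun s _ => ?_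
  rw [← k.nm_comp]
  exact k.nm_id _ _

/-! ### Evaluation at points -/

/-- The value in `k(G/e)` of an element of `k(X)` at a point `x` of `X`: its restriction along
the orbit map `G/e → X` of `x`. -/
def ev (k : TambaraFunctor.{u} G) {X : FinGSet G} (x : X) : k.obj X →+* k.bottom :=
  k.res (orbitMap x)

theorem ev_smul (k : TambaraFunctor.{u} G) {X : FinGSet G} (g : G) (x : X) (a : k.obj X) :
    k.ev (g • x) a = g • k.ev x a := by
  have h : orbitMap (g • x) = (orbitMap x).comp (rightMul g) := by
    ext y
    exact smul_smul (M := G) y g x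
  change k.res _ a = k.res (rightMul g) (k.res _ a)
  rw [h, k.res_comp]

theorem ev_res (k : TambaraFunctor.{u} G) {X Y : FinGSet G} (f : X →[G] Y) (x : X)
    (a : k.obj Y) : k.ev x (k.res f a) = k.ev (f x) a := by
  have h : orbitMap (f x) = f.comp (orbitMap x) := by
    ext y
    exact (f.map_smul (y : G) x).symm
  change k.res _ (k.res f a) = k.res _ a
  rw [h, k.res_comp]

theorem ev_one (k : TambaraFunctor.{u} G) (a : k.bottom) :
    k.ev (X := free G) (1 : G) a = a := by
  have h : orbitMap (X := free G) (1 : G) = MulActionHom.id G := by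
    ext y
    exact mul_one (M := G) y
  change k.res _ a = a
  rw [h]
  exact k.res_id _ _

/-- The pullback of `f : X → Y` along the orbit map of a point `y` is the product of `G` with the
fibre over `y`. -/
theorem isPullbackSquare_fiber {X Y : FinGSet G} (f : X →[G] Y) (y : Y) :
    IsPullbackSquare (freeOnLift (Subtype.val : {x : X // f x = y} → X))
      (freeOnFst {x : X // f x = y}) f (orbitMap y) := by
  constructor
  · rintro ⟨g, x, rfl⟩
    exact f.map_smul g x
  · intro x (g : G) (h : f x = g • y)
    refine ⟨(g, ⟨g⁻¹ • x, by rw [map_smul, h, inv_smul_smul]⟩),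
      ⟨smul_inv_smul g x, rfl⟩, ?_⟩
    rintro ⟨g', x', hx'⟩ ⟨h1, h2⟩
    change g' • x' = x at h1
    change g' = g at h2
    subst h1 h2
    exact Prod.ext rfl (Subtype.ext (inv_smul_smul g' x').symm)

theorem ev_tr (k : TambaraFunctor.{u} G) {X Y : FinGSet G} (f : X →[G] Y) (y : Y)
    [Fintype {x : X // f x = y}] (a : k.obj X) :
    k.ev y (k.tr f a) = ∑ x : {x : X // f x = y}, k.ev x.1 a := by
  change k.res _ _ = _
  rw [k.res_tr _ _ _ _ (isPullbackSquare_fiber f y), tr_freeOnFst]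
  refine Finset.sum_congr rfl fun x _ => ?_
  rw [← k.res_comp]
  rfl

theorem ev_nm (k : TambaraFunctor.{u} G) {X Y : FinGSet G} (f : X →[G] Y) (y : Y)
    [Fintype {x : X // f x = y}] (a : k.obj X) :
    k.ev y (k.nm f a) = ∏ x : {x : X // f x = y}, k.ev x.1 a := by
  change k.res _ _ = _
  rw [k.res_nm _ _ _ _ (isPullbackSquare_fiber f y), nm_freeOnFst]
  refine Finset.prod_congr rfl fun x _ => ?_
  rw [← k.res_comp]
  rfl

end Finite

end TambaraFunctor
namespace TambaraFunctor

open FinGSet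

variable {G : Type} [Group G]

/-! ### Tambara subfunctors, products and kernel pairs -/

/-- The Tambara subfunctor on a family of subrings closed under restrictions, transfers and norms.
Additivity is inherited because elements on the two halves of a disjoint union are glued by
transfers. -/
def sub (k : TambaraFunctor.{u} G) (S : ∀ X, Subring (k.obj X))
    (hres : ∀ {X Y : FinGSet G} (f : X →[G] Y) (a : k.obj Y), a ∈ S Y → k.res f a ∈ S X)
    (htr : ∀ {X Y : FinGSet G} (f : X →[G] Y) (a : k.obj X), a ∈ S X → k.tr f a ∈ S Y)
    (hnm : ∀ {X Y : FinGSet G} (f : X →[G] Y) (a : k.obj X), a ∈ S X → k.nm f a ∈ S Y) :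
    TambaraFunctor.{u} G where
  obj X := S X
  res {X Y} f := (k.res f).restrict (S Y) (S X) (hres f)
  tr f :=
    { toFun := fun a => ⟨k.tr f a, htr f a a.2⟩
      map_zero' := Subtype.ext (map_zero (k.tr f))
      map_add' := fun a b => Subtype.ext (map_add (k.tr f) a.1 b.1) }
  nm f :=
    { toFun := fun a => ⟨k.nm f a, hnm f a a.2⟩
      map_one' := Subtype.ext (map_one (k.nm f))
      map_mul' := fun a b => Subtype.ext (map_mul (k.nm f) a.1 b.1) }
  res_id X a := Subtype.ext (k.res_id X a.1)
  tr_id X a := Subtype.ext (k.tr_id X a.1)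
  nm_id X a := Subtype.ext (k.nm_id X a.1)
  res_comp g f a := Subtype.ext (k.res_comp g f a.1)
  tr_comp g f a := Subtype.ext (k.tr_comp g f a.1)
  nm_comp g f a := Subtype.ext (k.nm_comp g f a.1)
  subsingleton_of_isEmpty X hX :=
    have := k.subsingleton_of_isEmpty X hX
    inferInstance
  bijective_of_coprod {X Y Z} i j h := by
    have hi : Function.Injective i := fun x y hxy => Sum.inl_injective (h.1 hxy)
    have hj : Function.Injective j := fun x y hxy => Sum.inr_injective (h.1 hxy)
    have hij : ∀ x y, i x ≠ j y := fun x y hxy => Sum.inl_ne_inr (h.1 hxy)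
    refine ⟨fun a b hab => Subtype.ext ((k.bijective_of_coprod i j h).1 (Prod.ext
      (congrArg (fun c => (c.1 : k.obj X)) hab) (congrArg (fun c => (c.2 : k.obj Y)) hab))), ?_⟩
    rintro ⟨a, b⟩
    refine ⟨⟨k.tr i a + k.tr j b, (S Z).add_mem (htr i a a.2) (htr j b b.2)⟩,
      Prod.ext (Subtype.ext ?_) (Subtype.ext ?_)⟩
    · change k.res i (k.tr i a + k.tr j b) = a
      rw [map_add, k.res_tr_of_injective i hi,
        k.res_tr_of_disjoint j i fun x y e => hij y x e.symm, add_zero]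
    · change k.res j (k.tr i a + k.tr j b) = b
      rw [map_add, k.res_tr_of_injective j hj, k.res_tr_of_disjoint i j hij, zero_add]
  res_tr g' f' f g h a := Subtype.ext (k.res_tr g' f' f g h a.1)
  res_nm g' f' f g h a := Subtype.ext (k.res_nm g' f' f g h a.1)
  nm_tr q f e t π h a := Subtype.ext (k.nm_tr q f e t π h a.1)

/-- The levelwise product of two Tambara functors. -/
def prod (k l : TambaraFunctor.{u} G) : TambaraFunctor.{u} G where
  obj X := k.obj X × l.obj X
  res f := (k.res f).prodMap (l.res f)
  tr f := (k.tr f).prodMap (l.tr f)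
  nm f := (k.nm f).prodMap (l.nm f)
  res_id X a := Prod.ext (k.res_id X a.1) (l.res_id X a.2)
  tr_id X a := Prod.ext (k.tr_id X a.1) (l.tr_id X a.2)
  nm_id X a := Prod.ext (k.nm_id X a.1) (l.nm_id X a.2)
  res_comp g f a := Prod.ext (k.res_comp g f a.1) (l.res_comp g f a.2)
  tr_comp g f a := Prod.ext (k.tr_comp g f a.1) (l.tr_comp g f a.2)
  nm_comp g f a := Prod.ext (k.nm_comp g f a.1) (l.nm_comp g f a.2)
  subsingleton_of_isEmpty X hX :=
    have := k.subsingleton_of_isEmpty X hX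
    have := l.subsingleton_of_isEmpty X hX
    inferInstance
  bijective_of_coprod i j h := by
    have hk := k.bijective_of_coprod i j h
    have hl := l.bijective_of_coprod i j h
    constructor
    · intro a b hab
      simp only [Prod.ext_iff] at hab
      exact Prod.ext (hk.1 (Prod.ext hab.1.1 hab.2.1)) (hl.1 (Prod.ext hab.1.2 hab.2.2))
    · rintro ⟨⟨a, a'⟩, ⟨b, b'⟩⟩
      obtain ⟨c, hc⟩ := hk.2 (a, b)
      obtain ⟨c', hc'⟩ := hl.2 (a', b')
      simp only [Prod.ext_iff] at hc hc'
      exact ⟨(c, c'), Prod.ext (Prod.ext hc.1 hc'.1) (Prod.ext hc.2 hc'.2)⟩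
  res_tr g' f' f g h a := Prod.ext (k.res_tr g' f' f g h a.1) (l.res_tr g' f' f g h a.2)
  res_nm g' f' f g h a := Prod.ext (k.res_nm g' f' f g h a.1) (l.res_nm g' f' f g h a.2)
  nm_tr q f e t π h a := Prod.ext (k.nm_tr q f e t π h a.1) (l.nm_tr q f e t π h a.2)

/-- The kernel pair `k ×_l k` of a morphism `φ : k ⟶ l`. -/
def kernelPair {k l : TambaraFunctor.{u} G} (φ : k ⟶ l) : TambaraFunctor.{u} G :=
  (k.prod k).sub
    (fun X => ((φ.app X).comp (RingHom.fst (k.obj X) (k.obj X))).eqLocus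
      ((φ.app X).comp (RingHom.snd (k.obj X) (k.obj X))))
    (fun {X Y} f a (h : φ.app Y a.1 = φ.app Y a.2) => by
      change φ.app X (k.res f a.1) = φ.app X (k.res f a.2)
      rw [φ.app_res, φ.app_res, h])
    (fun {X Y} f a (h : φ.app X a.1 = φ.app X a.2) => by
      change φ.app Y (k.tr f a.1) = φ.app Y (k.tr f a.2)
      rw [φ.app_tr, φ.app_tr, h])
    (fun {X Y} f a (h : φ.app X a.1 = φ.app X a.2) => by
      change φ.app Y (k.nm f a.1) = φ.app Y (k.nm f a.2)
      rw [φ.app_nm, φ.app_nm, h])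

/-- The first projection of the kernel pair. -/
def kernelPairFst {k l : TambaraFunctor.{u} G} (φ : k ⟶ l) : kernelPair φ ⟶ k :=
  Hom.mk (fun _ => (RingHom.fst _ _).comp (Subring.subtype _))
    (fun _ _ => rfl) (fun _ _ => rfl) (fun _ _ => rfl)

/-- The second projection of the kernel pair. -/
def kernelPairSnd {k l : TambaraFunctor.{u} G} (φ : k ⟶ l) : kernelPair φ ⟶ k :=
  Hom.mk (fun _ => (RingHom.snd _ _).comp (Subring.subtype _))
    (fun _ _ => rfl) (fun _ _ => rfl) (fun _ _ => rfl)

/-- The two projections of the kernel pair of a monomorphism agree. -/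
theorem injective_of_mono {k l : TambaraFunctor.{u} G} (φ : k ⟶ l) [Mono φ] (X : FinGSet G) :
    Function.Injective (φ.app X) := by
  intro a b hab
  have h : kernelPairFst φ ≫ φ = kernelPairSnd φ ≫ φ :=
    Hom.ext (funext fun Y => RingHom.ext fun c => c.2)
  have h' := (cancel_mono φ).1 h
  exact congrArg (fun ψ : kernelPair φ ⟶ k => ψ.app X ⟨(a, b), hab⟩) h'

theorem mono_of_injective {k l : TambaraFunctor.{u} G} (φ : k ⟶ l)
    (h : ∀ X, Function.Injective (φ.app X)) : Mono φ where
  right_cancellation _ _ hαβ := Hom.ext (funext fun X => RingHom.ext fun c =>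
    h X (congrArg (fun ψ : _ ⟶ l => ψ.app X c) hαβ))

/-- A bijective morphism is an isomorphism. -/
theorem nonempty_iso_of_bijective {k l : TambaraFunctor.{u} G} (φ : k ⟶ l)
    (h : ∀ X, Function.Bijective (φ.app X)) : Nonempty (k ≅ l) := by
  let e := fun X => RingEquiv.ofBijective (φ.app X) (h X)
  have he : ∀ X a, φ.app X ((e X).symm a) = a := fun X a => (e X).apply_symm_apply a
  let ψ : l ⟶ k := Hom.mk (fun X => (e X).symm.toRingHom)
    (fun {X Y} f a => (h X).1 (by
      change φ.app X ((e X).symm _) = φ.app X (k.res f ((e Y).symm a))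
      rw [φ.app_res, he, he]))
    (fun {X Y} f a => (h Y).1 (by
      change φ.app Y ((e Y).symm _) = φ.app Y (k.tr f ((e X).symm a))
      rw [φ.app_tr, he, he]))
    (fun {X Y} f a => (h Y).1 (by
      change φ.app Y ((e Y).symm _) = φ.app Y (k.nm f ((e X).symm a))
      rw [φ.app_nm, he, he]))
  exact ⟨⟨φ, ψ, Hom.ext (funext fun X => RingHom.ext fun a => (e X).symm_apply_apply a),
    Hom.ext (funext fun X => RingHom.ext fun a => he X a)⟩⟩

/-! ### The Tambara functor of all functions to a ring -/

attribute [local instance] Fintype.ofFinite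

/-- For a pullback square, the fibre of `f'` over `v` is the fibre of `f` over `g v`. -/
noncomputable def _root_.IsPullbackSquare.fiberEquiv {W X V Y : Type} {g' : W → X} {f' : W → V}
    {f : X → Y} {g : V → Y} (h : IsPullbackSquare g' f' f g) (v : V) :
    {w // f' w = v} ≃ {x // f x = g v} :=
  Equiv.ofBijective (fun w => ⟨g' w.1, by rw [h.1, w.2]⟩) <| by
    constructor
    · rintro ⟨w, rfl⟩ ⟨w', hw'⟩ hww
      obtain ⟨_, _, hu⟩ := h.2 (g' w) (f' w) (h.1 w)
      exact Subtype.ext ((hu w ⟨rfl, rfl⟩).trans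
        (hu w' ⟨(congrArg Subtype.val hww).symm, hw'⟩).symm)
    · rintro ⟨x, hx⟩
      obtain ⟨w, ⟨rfl, hw⟩, _⟩ := h.2 x v hx
      exact ⟨⟨w, hw⟩, rfl⟩

/-- The fibre of `π : P → Y` over `y` in an exponential diagram is the set of sections over the
fibre of `f : X → Y`, written as a product of fibres of `q : A → X`. A point `c` over `y` and a
point `x` over `y` come from a unique `z : E`, and `c` corresponds to the section `x ↦ e z`. -/
theorem _root_.IsExponentialDiagram.exists_sectionEquiv {A X Y E P : Type} {q : A → X}
    {f : X → Y} {e : E → A} {t : E → P} {π : P → Y} (h : IsExponentialDiagram q f e t π) (y : Y) :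
    ∃ Φ : {c // π c = y} ≃ ∀ x : {x // f x = y}, {a // q a = x.1},
      ∀ (c : {c // π c = y}) (z : E) (hz : f (q (e z)) = y), t z = c.1 →
        (Φ c ⟨q (e z), hz⟩ : A) = e z := by
  have H : ∀ (c : {c // π c = y}) (x : {x // f x = y}), ∃ z : E, q (e z) = x.1 ∧ t z = c.1 :=
    fun c x => (h.isPullback.2 x.1 c.1 (x.2.trans c.2.symm)).exists
  choose s hs using H
  have hs' : ∀ (c : {c // π c = y}) (z : E) (hz : f (q (e z)) = y), t z = c.1 →
      s c ⟨q (e z), hz⟩ = z := fun c z hz hc =>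
    (h.isPullback.2 (q (e z)) c.1 (hz.trans c.2.symm)).unique (hs c ⟨q (e z), hz⟩) ⟨rfl, hc⟩
  refine ⟨Equiv.ofBijective (fun c x => ⟨e (s c x), (hs c x).1⟩) ⟨?_, ?_⟩, ?_⟩
  · intro c c' hcc
    have hc : ∀ x, e (s c x) = e (s c' x) := fun x => congrArg Subtype.val (congrFun hcc x)
    obtain ⟨_, _, hu⟩ := h.existsUnique_section y (fun x => e (s c x)) fun x => (hs c x).1
    refine Subtype.ext ((hu c.1 ⟨c.2, fun z hz hzc => ?_⟩).trans
      (hu c'.1 ⟨c'.2, fun z hz hzc => ?_⟩).symm)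
    · rw [hs' c z hz hzc]
    · rw [hc, hs' c' z hz hzc]
  · intro σ
    obtain ⟨c, ⟨hc, hσ⟩, _⟩ := h.existsUnique_section y (fun x => (σ x).1) fun x => (σ x).2
    refine ⟨⟨c, hc⟩, funext fun x => Subtype.ext ?_⟩
    obtain ⟨h1, h2⟩ := hs ⟨c, hc⟩ x
    change e (s ⟨c, hc⟩ x) = (σ x).1
    rw [hσ _ (by rw [h1, x.2]) h2]
    have : (⟨q (e (s ⟨c, hc⟩ x)), by rw [h1, x.2]⟩ : {x // f x = y}) = x := Subtype.ext h1
    rw [this]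
  · intro c z hz hzc
    change e (s c ⟨q (e z), hz⟩) = e z
    rw [hs' c z hz hzc]

/-- The fibre of a composite is the disjoint union of fibres. -/
def fiberCompEquiv {X Y Z : Type} (g : Y → Z) (f : X → Y) (z : Z) :
    {x // g (f x) = z} ≃ Σ y : {y // g y = z}, {x // f x = y.1} where
  toFun x := ⟨⟨f x.1, x.2⟩, ⟨x.1, rfl⟩⟩
  invFun w := ⟨w.2.1, by rw [w.2.2, w.1.2]⟩
  left_inv _ := rfl
  right_inv := by
    rintro ⟨⟨_, _⟩, ⟨x, h⟩⟩
    cases h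
    rfl

/-- The Tambara functor `X ↦ Fun(X, R)`; restrictions are precompositions, and transfers and norms
are sums and products over fibres. It is the coinduction of the ring `R` from the trivial group. -/
noncomputable def functions (G : Type) [Group G] (R : Type u) [CommRing R] :
    TambaraFunctor.{u} G where
  obj X := X → R
  res f := RingHom.pi fun x => Pi.evalRingHom _ (f x)
  tr f :=
    { toFun := fun a y => ∑ x : {x // f x = y}, a x.1
      map_zero' := funext fun y => Finset.sum_const_zero
      map_add' := fun a b => funext fun y => Finset.sum_add_distrib }
  nm f :=
    { toFun := fun a y => ∏ x : {x // f x = y}, a x.1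
      map_one' := funext fun y => Finset.prod_const_one
      map_mul' := fun a b => funext fun y => Finset.prod_mul_distrib }
  res_id X a := rfl
  tr_id X a := funext fun y =>
    Finset.sum_eq_single (f := fun x : {x // MulActionHom.id G (X := X) x = y} => a x.1)
      ⟨y, rfl⟩ (fun x _ hx => (hx (Subtype.ext x.2)).elim)
      fun h => (h (@Finset.mem_univ _ (_) _)).elim
  nm_id X a := funext fun y =>
    Finset.prod_eq_single (f := fun x : {x // MulActionHom.id G (X := X) x = y} => a x.1)
      ⟨y, rfl⟩ (fun x _ hx => (hx (Subtype.ext x.2)).elim)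
      fun h => (h (@Finset.mem_univ _ (_) _)).elim
  res_comp g f a := rfl
  tr_comp g f a := funext fun z => by
    exact (Fintype.sum_equiv (fiberCompEquiv g f z) _ (fun w => a w.2.1) fun _ => rfl).trans
      ((Fintype.sum_congr _ _ fun _ => rfl).trans (Fintype.sum_sigma _))
  nm_comp g f a := funext fun z => by
    exact (Fintype.prod_equiv (fiberCompEquiv g f z) _ (fun w => a w.2.1) fun _ => rfl).trans
      ((Fintype.prod_congr _ _ fun _ => rfl).trans (Fintype.prod_sigma _))
  subsingleton_of_isEmpty X hX := inferInstance
  bijective_of_coprod i j h := by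
    let E := (Equiv.ofBijective _ h).arrowCongr (Equiv.refl R)
    exact ((Equiv.sumArrowEquivProdArrow _ _ R).bijective.comp E.symm.bijective)
  res_tr g' f' f g h a := funext fun v =>
    (Fintype.sum_equiv (h.fiberEquiv v) _ _ fun _ => rfl).symm
  res_nm g' f' f g h a := funext fun v =>
    (Fintype.prod_equiv (h.fiberEquiv v) _ _ fun _ => rfl).symm
  nm_tr q f e t π h a := funext fun y => by
    obtain ⟨Φ, hΦ⟩ := h.exists_sectionEquiv y
    change ∏ x : {x // f x = y}, ∑ b : {b // q b = x.1}, a b.1 =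
      ∑ c : {c // π c = y}, ∏ z : {z // t z = c.1}, a (e z.1)
    let _ := Classical.decEq {x // f x = y}
    -- Expanding the product of sums gives a sum over sections.
    refine (Fintype.prod_sum fun (x : {x // f x = y}) (b : {b // q b = x.1}) => a b.1).trans ?_
    refine (Fintype.sum_equiv Φ _ _ fun c => ?_).symm
    obtain ⟨c, rfl⟩ := c
    refine Fintype.prod_equiv (h.isPullback.fiberEquiv c) _ _ fun z => ?_
    rw [← hΦ ⟨c, rfl⟩ z.1 ((h.isPullback.1 z.1).trans (congrArg π z.2)) z.2]
    rfl

end TambaraFunctor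

/-! ### Induced `G`-sets -/

namespace FinGSet

variable {G : Type} [Group G] {H : Subgroup G}

/-- The equivalence relation `(g * h, y) ∼ (g, h • y)` on `G × Y`. -/
def indSetoid (H : Subgroup G) (Y : FinGSet H) : Setoid (G × Y) where
  r a b := ∃ h : H, a.1 = b.1 * h ∧ h • a.2 = b.2
  iseqv :=
    { refl := fun a => ⟨1, by simp, one_smul H a.2⟩
      symm := by
        rintro ⟨a, x⟩ ⟨b, y⟩ ⟨h, h1, h2⟩
        refine ⟨h⁻¹, ?_, ?_⟩
        · change b = a * _
          rw [show a = b * h from h1]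
          simp
        · rw [show y = h • x from h2.symm]
          exact inv_smul_smul h x
      trans := by
        rintro ⟨a, x⟩ ⟨b, y⟩ ⟨c, z⟩ ⟨h, h1, h2⟩ ⟨h', h1', h2'⟩
        refine ⟨h' * h, ?_, ?_⟩
        · change a = c * _
          rw [show a = b * h from h1, show b = c * h' from h1']
          simp [mul_assoc]
        · rw [mul_smul, show h • x = y from h2, show h' • y = z from h2'] }

/-- The induced `G`-set `G ×_H Y` of an `H`-set `Y`. -/
def ind [Finite G] (H : Subgroup G) (Y : FinGSet H) : FinGSet G where
  carrier := Quotient (indSetoid H Y)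
  action :=
    { smul := fun g => Quotient.map (fun a => (g * a.1, a.2)) fun a b ⟨h, h1, h2⟩ =>
        ⟨h, by rw [h1, mul_assoc], h2⟩
      one_smul := by
        rintro ⟨a, y⟩
        exact congrArg (Quotient.mk _) (Prod.ext (one_mul a) rfl)
      mul_smul := by
        rintro g g' ⟨a, y⟩
        exact congrArg (Quotient.mk _) (Prod.ext (mul_assoc g g' a) rfl) }

variable [Finite G]

/-- The class of `(g, y)` in `G ×_H Y`. -/
def indMk {Y : FinGSet H} (g : G) (y : Y) : ind H Y :=
  Quotient.mk (indSetoid H Y) (g, y)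

theorem indMk_eq_iff {Y : FinGSet H} {g g' : G} {y y' : Y} :
    indMk g y = indMk g' y' ↔ ∃ h : H, g = g' * h ∧ h • y = y' :=
  ⟨fun h => Quotient.exact h, fun h => Quotient.sound h⟩

theorem exists_indMk {Y : FinGSet H} (w : ind H Y) : ∃ (g : G) (y : Y), indMk g y = w := by
  obtain ⟨g, y⟩ := w
  exact ⟨g, y, rfl⟩

theorem smul_indMk {Y : FinGSet H} (g g' : G) (y : Y) :
    g • indMk g' y = indMk (g * g') y :=
  rfl

theorem indMk_coe {Y : FinGSet H} (h : H) (y : Y) : indMk (h : G) y = indMk 1 (h • y) :=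
  indMk_eq_iff.2 ⟨h, by simp, rfl⟩

theorem indMk_one_injective {Y : FinGSet H} {y y' : Y}
    (h : indMk (1 : G) y = indMk 1 y') : y = y' := by
  obtain ⟨a, h1, rfl⟩ := indMk_eq_iff.1 h
  have : a = 1 := Subtype.ext (by simpa using h1.symm)
  rw [this, one_smul]

/-- The equivariant map `G ×_H Y → X`, `(g, y) ↦ g • f y`, induced by an `H`-equivariant
map `f : Y → X`. -/
def indLift {Y : FinGSet H} {X : FinGSet G} (f : Y → X)
    (hf : ∀ (h : H) (y : Y), f (h • y) = (h : G) • f y) : ind H Y →[G] X where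
  toFun := Quotient.lift (fun a : G × Y => a.1 • f a.2) <| by
    rintro ⟨a, x⟩ ⟨b, y⟩ ⟨h, h1, h2⟩
    change a • f x = b • f y
    rw [show a = b * h from h1, show y = h • x from h2.symm, mul_smul, hf]
  map_smul' := by
    rintro g ⟨a, y⟩
    exact mul_smul g a (f y)

/-- The equivariant map `G ×_H X → X`, `(g, x) ↦ g • x`. -/
def indCounit (H : Subgroup G) (X : FinGSet G) : ind H (X.restrict H) →[G] X :=
  indLift (fun x : X => x) fun _ _ => rfl

/-- The map `G ×_H Y → G ×_H Z` induced by an `H`-equivariant map. -/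
def indMap {Y Z : FinGSet H} (f : Y →[H] Z) : ind H Y →[G] ind H Z where
  toFun := Quotient.map (fun a => (a.1, f a.2)) fun a b ⟨h, h1, h2⟩ =>
    ⟨h, h1, by rw [← map_smul, h2]⟩
  map_smul' := by
    rintro g ⟨a, y⟩
    rfl

theorem indMap_indMk {Y Z : FinGSet H} (f : Y →[H] Z) (g : G) (y : Y) :
    indMap f (indMk g y) = indMk g (f y) :=
  rfl

/-- Induction does not change the fibres of a map. -/
noncomputable def indFiberEquiv {Y Z : FinGSet H} (f : Y →[H] Z) (z : Z) :
    {y // f y = z} ≃ {w // indMap f w = indMk 1 z} :=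
  Equiv.ofBijective (fun y => ⟨indMk 1 y.1, by rw [indMap_indMk, y.2]⟩) <| by
    constructor
    · intro y y' h
      exact Subtype.ext (indMk_one_injective (congrArg Subtype.val h))
    · rintro ⟨w, hw⟩
      obtain ⟨g, y, rfl⟩ := exists_indMk w
      obtain ⟨h, h1, rfl⟩ := indMk_eq_iff.1 hw
      obtain rfl : g = h := by simpa using h1
      exact ⟨⟨h • y, map_smul f h y⟩, Subtype.ext (indMk_coe h y).symm⟩

/-- The equivariant map `G ×_H H → G`, `(g, h) ↦ g * h`. -/
def indFree (H : Subgroup G) : ind H (free H) →[G] free G :=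
  indLift (fun h : H => (h : G)) fun _ _ => rfl

theorem indFree_indMk_one :
    indFree H (indMk (Y := free H) (1 : G) (1 : H)) = (1 : G) :=
  mul_one (1 : G)

/-- The equivariant surjection `G × Y → G ×_H Y`. -/
def indCover (H : Subgroup G) (Y : FinGSet H) : freeOn G Y →[G] ind H Y where
  toFun := Quotient.mk (indSetoid H Y)
  map_smul' := fun _ _ => rfl

end FinGSet

namespace TambaraFunctor

open FinGSet

variable {G : Type} [Group G] [Finite G]

attribute [local instance] Fintype.ofFinite

/-! ### Field-like Tambara functors and residue fields of the bottom level -/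

/-- Evaluation at points modulo an ideal `m` of the bottom level, as a morphism from `k` to the
Tambara functor of functions to `k(G/e) / m`. The ideal need not be invariant. -/
noncomputable def residue (k : TambaraFunctor.{u} G) (m : Ideal k.bottom) :
    k ⟶ functions G (k.bottom ⧸ m) :=
  Hom.mk (fun _ => RingHom.pi fun x => (Ideal.Quotient.mk m).comp (k.ev x))
    (fun f a => funext fun x => congrArg (Ideal.Quotient.mk m) (k.ev_res f x a))
    (fun f a => funext fun y =>
      (congrArg (Ideal.Quotient.mk m) (k.ev_tr f y a)).trans (map_sum _ _ _))
    (fun f a => funext fun y =>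
      (congrArg (Ideal.Quotient.mk m) (k.ev_nm f y a)).trans (map_prod _ _ _))

/-- A field-like `k` embeds in the functions to `k(G/e) / m` for every proper ideal `m`. -/
theorem residue_injective {k : TambaraFunctor.{u} G} (hk : k.IsFieldLike) (m : Ideal k.bottom)
    (hm : m ≠ ⊤) (X : FinGSet G) : Function.Injective ((k.residue m).app X) := by
  have : Nontrivial (k.bottom ⧸ m) := Ideal.Quotient.nontrivial_iff.2 hm
  have : Nonempty (free G) := ⟨(1 : G)⟩
  have := hk.2 _ (k.residue m) ⟨free G, inferInstanceAs (Nontrivial (free G → k.bottom ⧸ m))⟩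
  exact injective_of_mono _ X

/-- A Tambara functor is field-like if its bottom level is a field and its elements are detected
by their values at points. -/
theorem isFieldLike_of_isField_bottom {l : TambaraFunctor.{u} G} (hl : IsField l.bottom)
    (hev : ∀ (X : FinGSet G) (a : l.obj X), (∀ x, l.ev x a = 0) → a = 0) : l.IsFieldLike := by
  have hnt : Nontrivial l.bottom := hl.nontrivial
  refine ⟨⟨free G, hnt⟩, fun l' φ hl' => mono_of_injective φ fun X => ?_⟩
  have := nontrivial_bottom hl'
  let _ := hl.toField
  rw [injective_iff_map_eq_zero]
  intro a ha
  refine hev X a fun x => ?_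
  let ψ : l.bottom →+* l'.bottom := φ.app (free G)
  refine (injective_iff_map_eq_zero ψ).1 ψ.injective _ ?_
  exact (φ.app_res (orbitMap x) a).trans (by rw [ha]; exact map_zero _)

/-- A field is not a coinduced ring for a proper subgroup `H`: the indicator function of `H` would
be a nontrivial idempotent. -/
theorem not_isSeparated_of_isField_bottom {l : TambaraFunctor.{u} G} (hl : IsField l.bottom) :
    ¬ l.IsSeparated := by
  classical
  rintro ⟨-, H, hH, R, _, _, φ, -⟩
  obtain ⟨x, hx⟩ : ∃ x, x ∉ H := by
    by_contra! h
    exact hH (eq_top_iff.2 fun x _ => h x)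
  have hl' : IsField (coindRing H R) := φ.symm.toMulEquiv.isField hl
  let _ := hl'.toField
  have hR : Nontrivial R := by
    by_contra h
    have := not_nontrivial_iff_subsingleton.1 h
    obtain ⟨a, b, hab⟩ := hl'.nontrivial
    exact hab (Subtype.ext (Subsingleton.elim _ _))
  let e : coindRing H R := ⟨fun y => if y ∈ H then 1 else 0, fun h y => by
    by_cases hy : y ∈ H <;> simp [H.mul_mem_cancel_left h.2, hy]⟩
  have he : e * (1 - e) = 0 := Subtype.ext (funext fun y => by
    change (if y ∈ H then 1 else 0) * (1 - (if y ∈ H then 1 else 0)) = (0 : R)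
    split_ifs <;> simp)
  rcases mul_eq_zero.1 he with h | h
  · have := congrFun (congrArg Subtype.val h) 1
    change (if (1 : G) ∈ H then 1 else 0) = (0 : R) at this
    simp [H.one_mem] at this
  · have := congrFun (congrArg Subtype.val h) x
    change 1 - (if x ∈ H then 1 else 0) = (0 : R) at this
    simp [hx] at this

/-! ### The decomposition subgroup of a maximal ideal -/

/-- The stabilizer of an ideal of the bottom level. -/
def stab (k : TambaraFunctor.{u} G) (m : Ideal k.bottom) : Subgroup G where
  carrier := {g | ∀ a : k.bottom, g • a ∈ m ↔ a ∈ m}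
  one_mem' a := by rw [one_smul]
  mul_mem' hg hg' a := by rw [mul_smul, hg, hg']
  inv_mem' {g} hg a := by rw [← hg, smul_inv_smul]

/-- The Chinese remainder theorem, applied to a maximal ideal and its other conjugates. -/
theorem exists_separating (k : TambaraFunctor.{u} G) (m : Ideal k.bottom) [hm : m.IsMaximal] :
    ∃ d : k.bottom, 1 - d ∈ m ∧ ∀ g ∉ k.stab m, g • d ∈ m := by
  classical
  let J : G → Ideal k.bottom := fun g => m.comap (MulSemiringAction.toRingEquiv G k.bottom g)
  have hJ : ∀ g ∈ Finset.univ.filter (· ∉ k.stab m), m ⊔ J g = ⊤ := by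
    intro g hg
    have : (J g).IsMaximal :=
      Ideal.comap_isMaximal_of_surjective _ (RingEquiv.surjective _)
    refine hm.coprime_of_ne this fun h => (Finset.mem_filter.1 hg).2 fun a => ?_
    conv_rhs => rw [h]
    rfl
  have h1 := Ideal.sup_iInf_eq_top hJ
  obtain ⟨c, hc, d, hd, hcd⟩ := Submodule.mem_sup.1 (h1 ▸ Submodule.mem_top (x := (1 : k.bottom)))
  refine ⟨d, ?_, fun g hg => ?_⟩
  · rw [← hcd, add_sub_cancel_right]
    exact hc
  · exact ((Submodule.mem_iInf _).1 ((Submodule.mem_iInf _).1 hd g) (by simpa using hg) :)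

/-- The `H`-Tambara functor of functions `y ↦ b(1, y) mod m` on an `H`-set `Y`, for
`b ∈ k(G ×_H Y)`. When `m` is maximal with stabilizer `H` and `k` is field-like, it is the
localization of the restriction of `k` to `H` at the idempotent which is `1` modulo `m` and `0`
modulo the other conjugates of `m`. -/
noncomputable def localPart (k : TambaraFunctor.{u} G) (m : Ideal k.bottom) (H : Subgroup G) :
    TambaraFunctor.{u} H :=
  (functions H (k.bottom ⧸ m)).sub
    (fun Y => (RingHom.pi fun y : Y => (Ideal.Quotient.mk m).comp
      (k.ev (indMk (1 : G) y))).range)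
    (fun {X Y} f a => by
      rintro ⟨b, rfl⟩
      exact ⟨k.res (indMap f) b,
        funext fun x => congrArg (Ideal.Quotient.mk m) (k.ev_res (indMap f) (indMk 1 x) b)⟩)
    (fun {X Y} f a => by
      rintro ⟨b, rfl⟩
      refine ⟨k.tr (indMap f) b, funext fun y => ?_⟩
      refine (congrArg (Ideal.Quotient.mk m) (k.ev_tr (indMap f) (indMk 1 y) b)).trans ?_
      rw [map_sum]
      exact (Fintype.sum_equiv (indFiberEquiv f y) _ _ fun _ => rfl).symm)
    (fun {X Y} f a => by
      rintro ⟨b, rfl⟩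
      refine ⟨k.nm (indMap f) b, funext fun y => ?_⟩
      refine (congrArg (Ideal.Quotient.mk m) (k.ev_nm (indMap f) (indMk 1 y) b)).trans ?_
      rw [map_prod]
      exact (Fintype.prod_equiv (indFiberEquiv f y) _ _ fun _ => rfl).symm)

/-- The zero set of an element of the local part is stable: `h • a ∈ m` if and only if `a ∈ m`
for `h` in the stabilizer of `m`. -/
theorem localPart_apply_smul (k : TambaraFunctor.{u} G) (m : Ideal k.bottom)
    {Y : FinGSet (k.stab m)}
    (f : (k.localPart m (k.stab m)).obj Y) (h : k.stab m) (y : Y) :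
    f.1 (h • y) = 0 ↔ f.1 y = 0 := by
  obtain ⟨_, b, rfl⟩ := f
  change Ideal.Quotient.mk m (k.ev (indMk (1 : G) (h • y)) b) = 0 ↔
    Ideal.Quotient.mk m (k.ev (indMk (1 : G) y) b) = 0
  rw [Ideal.Quotient.eq_zero_iff_mem, Ideal.Quotient.eq_zero_iff_mem, ← indMk_coe,
    ← h.2 (k.ev (indMk (1 : G) y) b), ← ev_smul, smul_indMk, mul_one]

/-- The bottom level of the local part at a maximal ideal is the residue field. -/
theorem isField_bottom_localPart (k : TambaraFunctor.{u} G) (m : Ideal k.bottom)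
    [m.IsMaximal] : IsField (k.localPart m (k.stab m)).bottom := by
  let ψ : (k.localPart m (k.stab m)).bottom →+* k.bottom ⧸ m :=
    (Pi.evalRingHom (fun _ : free (k.stab m) => k.bottom ⧸ m) (1 : k.stab m)).comp
      (Subring.subtype _)
  have hψ : Function.Bijective ψ := by
    constructor
    · rw [injective_iff_map_eq_zero]
      intro f hf
      refine Subtype.ext (funext fun h : k.stab m => ?_)
      have := (k.localPart_apply_smul m (Y := free (k.stab m)) f h (1 : k.stab m)).2 hf
      exact (congrArg f.1 (mul_one h)).symm.trans this
    · intro r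
      obtain ⟨r, rfl⟩ := Ideal.Quotient.mk_surjective r
      refine ⟨⟨_, k.res (indFree (k.stab m)) r, rfl⟩, ?_⟩
      refine congrArg (Ideal.Quotient.mk m) ((k.ev_res _ _ _).trans ?_)
      exact (congrArg (fun x : free G => k.ev x r) indFree_indMk_one).trans (k.ev_one r)
  exact (RingEquiv.ofBijective ψ hψ).toMulEquiv.isField
    ((Ideal.Quotient.maximal_ideal_iff_isField_quotient m).1 ‹_›)

theorem isFieldLike_localPart (k : TambaraFunctor.{u} G) (m : Ideal k.bottom)
    [m.IsMaximal] : (k.localPart m (k.stab m)).IsFieldLike := by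
  refine isFieldLike_of_isField_bottom (k.isField_bottom_localPart m) fun Y f hf => ?_
  refine Subtype.ext (funext fun y => ?_)
  have h := congrFun (congrArg Subtype.val (hf y)) (1 : k.stab m)
  change f.1 ((1 : k.stab m) • y) = 0 at h
  rwa [one_smul] at h

/-- The morphism from `k` to the coinduction of its local part. -/
noncomputable def toCoind (k : TambaraFunctor.{u} G) (m : Ideal k.bottom) (H : Subgroup G) :
    k ⟶ coind H (k.localPart m H) :=
  Hom.mk
    (fun X => ((k.residue m).app X).codRestrict
      (RingHom.pi fun y : X.restrict H => (Ideal.Quotient.mk m).comp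
        (k.ev (indMk (1 : G) y))).range fun a =>
      ⟨k.res (indCounit H X) a, funext fun x : X => congrArg (Ideal.Quotient.mk m) <|
        (k.ev_res _ _ _).trans (congrArg (fun y : X => k.ev y a) (one_smul G x))⟩)
    (fun f a => Subtype.ext ((k.residue m).app_res f a))
    (fun f a => Subtype.ext ((k.residue m).app_tr f a))
    (fun f a => Subtype.ext ((k.residue m).app_nm f a))

/-- An element of `k(G ×_H Y)` which modulo `m` is the indicator function of the points `(1, y)`,
obtained as a norm from `G × Y`. -/
theorem exists_indicator (k : TambaraFunctor.{u} G) (m : Ideal k.bottom) [m.IsMaximal]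
    (Y : FinGSet (k.stab m)) :
    ∃ D : k.obj (ind (k.stab m) Y),
      (∀ y, Ideal.Quotient.mk m (k.ev (indMk (1 : G) y) D) = 1) ∧
      ∀ g ∉ k.stab m, ∀ y, Ideal.Quotient.mk m (k.ev (indMk g y) D) = 0 := by
  obtain ⟨d, hd1, hd0⟩ := k.exists_separating m
  have hfst : ∀ w : freeOn G Y, k.ev w (k.res (freeOnFst Y.carrier) d) = w.1 • d := by
    rintro ⟨g, y⟩
    refine (k.ev_res (freeOnFst Y.carrier) _ d).trans ?_
    have h := k.ev_smul (X := free G) g (1 : G) d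
    rw [k.ev_one] at h
    exact (congrArg (fun x : free G => k.ev x d) (mul_one g).symm).trans h
  refine ⟨k.nm (indCover _ Y) (k.res (freeOnFst Y.carrier) d), fun y => ?_, fun g hg y => ?_⟩
  -- The fibre of `G × Y → G ×_H Y` over `(1, y)` lies over `H`, so its factors are all `1`.
  · rw [ev_nm, map_prod]
    refine Finset.prod_eq_one fun w _ => ?_
    obtain ⟨⟨g, y'⟩, hw⟩ := w
    obtain ⟨h, h1, -⟩ := indMk_eq_iff.1 hw
    obtain rfl : g = h := by simpa using h1
    rw [hfst, eq_comm, ← map_one (Ideal.Quotient.mk m), Ideal.Quotient.eq]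
    have := (h.2 _).2 hd1
    rwa [smul_sub, smul_one] at this
  -- Over `(g, y)` with `g ∉ H`, the factor of the point `(g, y)` itself vanishes.
  · rw [ev_nm, map_prod]
    refine Finset.prod_eq_zero (Finset.mem_univ ⟨(g, y), rfl⟩) ?_
    rw [hfst]
    exact Ideal.Quotient.eq_zero_iff_mem.2 (hd0 g hg)

/-- A section `b ∈ k(G ×_H X)` of the local part over `X` lifts to the transfer to `X` of `b`
multiplied by the indicator of the points `(1, x)`. -/
theorem toCoind_surjective (k : TambaraFunctor.{u} G) (m : Ideal k.bottom) [m.IsMaximal]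
    (X : FinGSet G) : Function.Surjective ((k.toCoind m (k.stab m)).app X) := by
  rintro ⟨_, b, rfl⟩
  obtain ⟨D, hD1, hD0⟩ := k.exists_indicator m (X.restrict (k.stab m))
  refine ⟨k.tr (indCounit _ X) (D * b), Subtype.ext (funext fun x : X => ?_)⟩
  let x₁ := indMk (Y := X.restrict (k.stab m)) (1 : G) x
  change Ideal.Quotient.mk m (k.ev x (k.tr (indCounit _ X) (D * b))) =
    Ideal.Quotient.mk m (k.ev x₁ b)
  -- The only point `(g, x')` with `g ∈ H` in the fibre over `x` is `(1, x)`.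
  rw [ev_tr, map_sum, Fintype.sum_eq_single ⟨x₁, one_smul G x⟩]
  · change Ideal.Quotient.mk m (k.ev x₁ (D * b)) = _
    rw [map_mul, map_mul, show Ideal.Quotient.mk m (k.ev x₁ D) = 1 from hD1 x, one_mul]
  · rintro ⟨w, hw⟩ hne
    obtain ⟨g, x', rfl⟩ := exists_indMk w
    rw [map_mul, map_mul, hD0 g, zero_mul]
    intro hg
    refine hne (Subtype.ext ((indMk_coe ⟨g, hg⟩ x').trans ?_))
    exact congrArg (indMk (Y := X.restrict (k.stab m)) (1 : G)) hw

theorem nonempty_iso_coind_localPart {k : TambaraFunctor.{u} G} (hk : k.IsFieldLike)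
    (m : Ideal k.bottom) [hm : m.IsMaximal] :
    Nonempty (k ≅ coind (k.stab m) (k.localPart m (k.stab m))) := by
  refine nonempty_iso_of_bijective (k.toCoind m (k.stab m)) fun X =>
    ⟨fun a b hab => ?_, k.toCoind_surjective m X⟩
  exact residue_injective hk m hm.ne_top X (congrArg Subtype.val hab)

end TambaraFunctor

/-! ### The decomposition theorem -/

theorem mainTheorem1 (p n : ℕ) (hp : p.Prime) (G : Type) [Group G] [Finite G] [IsCyclic G]
    (hG : Nat.card G = p ^ n) (k : TambaraFunctor.{u} G) (hk : k.IsFieldLike) :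
    ∃ s : ℕ, s ≤ n ∧ ∃ H : Subgroup G, Nat.card H = p ^ s ∧
      ∃ l : TambaraFunctor.{u} H, l.IsClarified ∧ IsField l.bottom ∧
        Nonempty (k ≅ TambaraFunctor.coind H l) := by
  have := TambaraFunctor.nontrivial_bottom hk.1
  obtain ⟨m, hm⟩ := Ideal.exists_maximal k.bottom
  obtain ⟨s, hs, hcard⟩ := (Nat.dvd_prime_pow hp).1 (hG ▸ (k.stab m).card_subgroup_dvd_card)
  have hfield := k.isField_bottom_localPart m
  exact ⟨s, hs, k.stab m, hcard, k.localPart m (k.stab m),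
    ⟨k.isFieldLike_localPart m, TambaraFunctor.not_isSeparated_of_isField_bottom hfield⟩,
    hfield, TambaraFunctor.nonempty_iso_coind_localPart hk m⟩
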